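/- Let $F:\mathbb{R}^d\to\mathbb{R}^d$ be $L$-Lipschitz ($L\ge 0$), let $G:\mathbb{R}^d\rightrightarrows\mathbb{R}^d$ be maximally monotone, let $\rho>0$, and let $x^*$ satisfy $0\in (F+G)(x^*)$ and the $\rho$-weak Minty variational inequality $\langle u,x-x^*\rangle\ge-\rho\|u\|^2$ for all $x\in\mathbb{R}^d$ and $u\in(F+G)(x)$. Let $\rho<\eta$ and $\eta L<1$, and write $J_A=(\mathrm{Id}+A)^{-1}$ for the resolvent of an operator $A$. For $x_0\in\mathbb{R}^d$ and $\alpha=1-\rho/\eta$ consider the inexact Krasnosel'skii-Mann iteration $$x_{k+1}=(1-\alpha)x_k+\alpha\, z^{(k)}_{N_k},\qquad N_k=\left\lceil\frac{4(1+\eta L)}{1-\eta L}\log\big(8(k+1)\log^2(k+2)\big)\right\rceil ,\qquad k\ge 0,$$ where $z^{(k)}_{N_k}$ is the result of $N_k$ steps of the forward-backward-forward method: with $\tau=\frac{1}{2(1+\eta L)}$ and $B_k(z)=z+\eta F(z)-x_k$, set $z^{(k)}_0=x_k$ and $$z^{(k)}_{t+1/2}=J_{\tau\eta G}\big(z^{(k)}_t-\tau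 B_k(z^{(k)}_t)\big),\qquad z^{(k)}_{t+1}=z^{(k)}_{t+1/2}+\tau B_k(z^{(k)}_t)-\tau B_k(z^{(k)}_{t+1/2}).$$ Let $\varepsilon>0$ and $K=\max\left\{1,\left\lceil\frac{11\|x_0-x^*\|^2}{(\eta-\rho)^2\varepsilon^2}\right\rceil\right\}$. Then for some $x^{\mathrm{out}}\in\{x_0,\dots,x_{K-1}\}$ the resolvent $J_{\eta(F+G)}$ is defined and single-valued at $x^{\mathrm{out}}$, and $$\eta^{-1}\|(\mathrm{Id}-J_{\eta(F+G)})(x^{\mathrm{out}})\|\le\varepsilon .$$ The total number of oracle calls (evaluations of $F$ and of the resolvent $J_{\tau\eta G}$) made in the first $K$ iterations is $$\widetilde O\left(\frac{(1+\eta L)\|x_0-x^*\|^2}{\varepsilon^2(\eta-\rho)^2(1-\eta L)}\right),$$ that is, with $\Lambda=\max\left\{1,\frac{\|x_0-x^*\|^2}{\varepsilon^2(\eta-\rho)^2}\right\}$, it is at most $C\,\frac{1+\eta L}{1-\eta L}\,\Lambda\,(1+\log\Lambda)$ for a universal constant $C$ (independent of $d,F,G,L,\eta,\rho,x_0,x^*,\varepsilon$).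 -/

import Mathlib

open scoped NNReal

noncomputable section

namespace WeakMVI

/-! ### Set-valued operators on a real inner product space -/

section Operators

variable {E : Type*} [NormedAddCommGroup E] [InnerProductSpace ℝ E]

/-- The set-valued operator `c A : x ↦ {c v : v ∈ A x}`. -/
def smulOp (c : ℝ) (A : E → Set E) : E → Set E :=
  fun x => {u | ∃ v ∈ A x, u = c • v}

/-- The set-valued operator `F + G : x ↦ {F x + v : v ∈ G x}`, with `F` single-valued. -/
def sumOp (F : E → E) (G : E → Set E) : E → Set E :=
  fun x => {u | ∃ v ∈ G x, u = F x + v}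

/-- Monotonicity of a set-valued operator. -/
def IsMonotoneOp (A : E → Set E) : Prop :=
  ∀ x y : E, ∀ u ∈ A x, ∀ v ∈ A y, 0 ≤ inner ℝ (u - v) (x - y)

/-- Maximal monotonicity: the graph is not strictly contained in the graph of another monotone
operator. -/
def IsMaximalMonotoneOp (A : E → Set E) : Prop :=
  IsMonotoneOp A ∧ ∀ B : E → Set E, IsMonotoneOp B → (∀ x, A x ⊆ B x) → B = A

/-- `xs` solves `0 ∈ (F + G)(xs)` and satisfies the `ρ`-weak Minty variational inequality
`⟨u, x - xs⟩ ≥ -ρ ‖u‖²` for every `(x, u)` in the graph of `F + G`. -/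
def IsWeakMVISolution (F : E → E) (G : E → Set E) (ρ : ℝ) (xs : E) : Prop :=
  (0 : E) ∈ sumOp F G xs ∧
    ∀ x : E, ∀ u ∈ sumOp F G x, inner ℝ u (x - xs) ≥ -ρ * ‖u‖ ^ 2

/-- The set-valued resolvent `J_A = (Id + A)⁻¹`: `y ∈ J_A x` iff `x ∈ y + A y`. -/
def resolventSet (A : E → Set E) (x : E) : Set E :=
  {y | ∃ u ∈ A y, x = y + u}

/-- The resolvent as a function: some element of `J_A x` (the only one when `A` is maximally
monotone); unspecified where `J_A x` is empty. -/
def resolvent (A : E → Set E) (x : E) : E :=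
  Classical.epsilon fun y => y ∈ resolventSet A x

end Operators

/-! ### Computations that count their oracle calls -/

/-- The result of a computation, with the number of oracle calls made by it. -/
structure Counted (α : Type*) where
  val : α
  calls : ℕ

namespace Counted

/-- A computation without oracle calls. -/
def pure {α : Type*} (a : α) : Counted α := ⟨a, 0⟩

/-- Sequential composition: the numbers of calls add up. -/
def bind {α β : Type*} (c : Counted α) (f : α → Counted β) : Counted β :=
  ⟨(f c.val).val, c.calls + (f c.val).calls⟩

/-- One call to the oracle `f` at the point `x`. -/
def query {α β : Type*} (f : α → β) (x : α) : Counted β := ⟨f x, 1⟩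

end Counted

/-! ### The algorithms -/

section Algorithms

variable {E : Type*} [NormedAddCommGroup E] [InnerProductSpace ℝ E]

/-- `N` steps of the forward-backward-forward method from `z₀` for `0 ∈ A z + B z`, where
`B z = Bin z - z₀`, with step size `τ`. The argument `evalB` evaluates `Bin`, and `resA` evaluates
`J_{τ A}`. In each step `Bin` is evaluated at `z_t` and at `z_{t+1/2}`, and `J_{τ A}` once. -/
def fbf (evalB resA : E → Counted E) (τ : ℝ) (z₀ : E) : ℕ → Counted E
  | 0 => Counted.pure z₀
  | t + 1 =>
    (fbf evalB resA τ z₀ t).bind fun z =>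
    (evalB z).bind fun b =>
    (resA (z - τ • (b - z₀))).bind fun zHalf =>
    (evalB zHalf).bind fun bHalf =>
    Counted.pure (zHalf + τ • (b - z₀) - τ • (bHalf - z₀))

/-- The number `N_k = ⌈4 (1 + η L) / (1 - η L) * log (8 (k + 1) log² (k + 2))⌉` of inner steps. -/
def innerSteps (η L : ℝ) (k : ℕ) : ℕ :=
  ⌈4 * (1 + η * L) / (1 - η * L) *
    Real.log (8 * ((k : ℝ) + 1) * Real.log ((k : ℝ) + 2) ^ 2)⌉₊

/-- The approximate resolvent `FBF (x, N, η G, Id + η F, 1 + η L)` of `η (F + G)` at `x`, with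
`τ = 1 / (2 (1 + η L))`. An evaluation of `Id + η F` is one call to `F`. -/
def approxResolvent (F : E → E) (G : E → Set E) (η L : ℝ) (N : ℕ) (x : E) : Counted E :=
  let τ : ℝ := 1 / (2 * (1 + η * L))
  fbf (fun z => (Counted.query F z).bind fun w => Counted.pure (z + η • w))
    (Counted.query (resolvent (smulOp τ (smulOp η G)))) τ x N

/-- The inexact Krasnoselskii-Mann iteration from `x₀`: after `k` iterations its value is the
iterate `x_k`, and its number of calls is the number of evaluations of `F` plus the number of
evaluations of resolvents of `G` made during these `k` iterations. Here `α = 1 - ρ / η`. -/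
def inexactKM (F : E → E) (G : E → Set E) (η L ρ : ℝ) (x₀ : E) : ℕ → Counted E
  | 0 => Counted.pure x₀
  | k + 1 =>
    (inexactKM F G η L ρ x₀ k).bind fun x =>
    (approxResolvent F G η L (innerSteps η L k) x).bind fun y =>
    Counted.pure ((1 - (1 - ρ / η)) • x + (1 - ρ / η) • y)

end Algorithms

end WeakMVI

end

namespace WeakMVI

variable {E : Type*} [NormedAddCommGroup E] [InnerProductSpace ℝ E]

/-! ### Minty's theorem -/

/-! By Minty's theorem and nonexpansiveness of resolvents, `z ↦ J_{ηG}(x - ηF z)` is an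
`ηL`-contraction of the whole space. Its fixed point is the unique value `p` of `J_{η(F+G)}` at `x`.
With `α = 1 - ρ/η`, the weak Minty inequality at `p` says that `r = α(x - p)` satisfies `‖r‖² ≤ ⟨r,
x - x*⟩`, so an exact step decreases the squared distance to `x*` by at least `‖r‖²`. The inner
problem is strongly monotone and Lipschitz, so forward-backward-forward converges linearly, with an
error relative to `‖x_k - p_k‖`. The squared relative error `q_k = 1/(5(k+1)^{3/2})` costs half of
the decrease and a factor `1 + 2q_k` (`norm_sub_add_sq_le`). Since `∑ q_k` is bounded, a discrete
Grönwall argument gives `∑ α²‖x_k - p_k‖² ≤ 11‖x₀ - x*‖²`, and the smallest of `K` residuals obeys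
the claim. The cost is three calls per inner step. -/

theorem convexOn_inner_add_sub (v y : E) :
    ConvexOn ℝ Set.univ fun z : E => inner ℝ (v + z) (z - y) := by
  refine ⟨convex_univ, fun z _ w _ a b ha hb hab => ?_⟩
  have key : a * inner ℝ (v + z) (z - y) + b * inner ℝ (v + w) (w - y)
      - inner ℝ (v + (a • z + b • w)) (a • z + b • w - y) = a * b * ‖z - w‖ ^ 2 := by
    obtain rfl : b = 1 - a := by linarith
    rw [← real_inner_self_eq_norm_sq]
    simp only [inner_add_left, inner_add_right, inner_sub_left, inner_sub_right,
      real_inner_smul_left, real_inner_smul_right, real_inner_comm z w]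
    ring
  have : 0 ≤ a * b * ‖z - w‖ ^ 2 := by positivity
  simp only [smul_eq_mul]
  linarith

/-- The value at the barycentre of a finite monotone family is at most `0`. -/
theorem sum_inner_barycentre_nonpos {ι : Type*} [Fintype ι] (y v : ι → E) (x : E)
    (hmono : ∀ i j, 0 ≤ inner ℝ (v i - v j) (y i - y j)) (w : ι → ℝ) (hw : ∀ i, 0 ≤ w i)
    (hw1 : ∑ i, w i = 1) :
    ∑ i, w i * inner ℝ (v i - x + ∑ j, w j • y j) ((∑ j, w j • y j) - y i) ≤ 0 := by
  set c := ∑ j, w j • y j with hc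
  have h1 : ∑ i, w i * inner ℝ (c - x) (c - y i) = 0 := by
    have : ∑ i, w i * inner ℝ (c - x) (c - y i) = inner ℝ (c - x) (∑ i, w i • (c - y i)) := by
      simp [inner_sum, real_inner_smul_right]
    rw [this]
    simp [smul_sub, Finset.sum_sub_distrib, ← Finset.sum_smul, hw1, ← hc]
  have h2 (i : ι) : inner ℝ (v i) (c - y i) = ∑ j, w j * inner ℝ (v i) (y j - y i) := by
    have : c - y i = ∑ j, w j • (y j - y i) := by
      simp [smul_sub, Finset.sum_sub_distrib, ← Finset.sum_smul, hw1, ← hc]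
    rw [this]
    simp [inner_sum, real_inner_smul_right]
  have h3 : ∑ i, w i * inner ℝ (v i) (c - y i)
      = ∑ i, ∑ j, w i * w j * inner ℝ (v i) (y j - y i) := by
    simp_rw [h2, Finset.mul_sum, mul_assoc]
  -- Symmetrizing in `i, j` turns twice the double sum into minus a nonnegative combination of the
  -- monotonicity products.
  have h4 : ∑ i, ∑ j, w i * w j * inner ℝ (v i) (y j - y i)
      = ∑ i, ∑ j, w i * w j * inner ℝ (v j) (y i - y j) := by
    rw [Finset.sum_comm]
    simp_rw [mul_comm (w _) (w _)]
  have h5 : (∑ i, ∑ j, w i * w j * inner ℝ (v i) (y j - y i))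
      + ∑ i, ∑ j, w i * w j * inner ℝ (v j) (y i - y j) ≤ 0 := by
    rw [← Finset.sum_add_distrib]
    refine Finset.sum_nonpos fun i _ => ?_
    rw [← Finset.sum_add_distrib]
    refine Finset.sum_nonpos fun j _ => ?_
    have e : inner ℝ (v i) (y j - y i) + inner ℝ (v j) (y i - y j)
        = - inner ℝ (v i - v j) (y i - y j) := by
      simp only [inner_sub_left, inner_sub_right]; ring
    rw [← mul_add, e]
    have := mul_nonneg (mul_nonneg (hw i) (hw j)) (hmono i j)
    linarith
  have h6 : ∑ i, w i * inner ℝ (v i - x + c) (c - y i)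
      = ∑ i, w i * inner ℝ (v i) (c - y i) + ∑ i, w i * inner ℝ (c - x) (c - y i) := by
    rw [← Finset.sum_add_distrib]
    refine Finset.sum_congr rfl fun i _ => ?_
    rw [← mul_add, ← inner_add_left, show v i - x + c = v i + (c - x) by abel]
  rw [h6, h1]
  linarith

/-- A finite monotone family extends to any prescribed value of `Id + A`. -/
theorem exists_forall_inner_nonpos_of_finite {ι : Type*} [Finite ι] (y v : ι → E) (x : E)
    (hmono : ∀ i j, 0 ≤ inner ℝ (v i - v j) (y i - y j)) :
    ∃ z : E, ∀ i, inner ℝ (v i - x + z) (z - y i) ≤ 0 := by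
  classical
  cases nonempty_fintype ι
  rcases isEmpty_or_nonempty ι with hι | ⟨⟨i₀⟩⟩
  · exact ⟨0, fun i => hι.elim i⟩
  -- Convex in `z` and linear in `w`, so Sion's theorem gives a saddle point `(a, b)`. Comparing the
  -- vertex `i` at `a` with the barycentre of the `y j` under `b` bounds the `i`-th value at `a` by
  -- `0`.
  let f : E → (ι → ℝ) → ℝ := fun z w => ∑ i, w i * inner ℝ (v i - x + z) (z - y i)
  have hcont (i : ι) : Continuous fun z : E => inner ℝ (v i - x + z) (z - y i) := by fun_prop
  have hlin (a : E) (w₁ w₂ : ι → ℝ) (s t : ℝ) : f a (s • w₁ + t • w₂) = s * f a w₁ + t * f a w₂ := by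
    simp only [f, Finset.mul_sum, ← Finset.sum_add_distrib]
    refine Finset.sum_congr rfl fun i _ => ?_
    simp only [Pi.add_apply, Pi.smul_apply, smul_eq_mul]
    ring
  obtain ⟨a, -, b, hb, hab⟩ := Sion.exists_isSaddlePointOn
    (X := convexHull ℝ (Set.range y)) (Y := stdSimplex ℝ ι) (f := f)
    ⟨y i₀, subset_convexHull ℝ _ ⟨i₀, rfl⟩⟩ (convex_convexHull ℝ _)
    ((Set.finite_range y).isCompact_convexHull ℝ)
    (fun w _ => (by fun_prop : Continuous fun z => f z w).lowerSemicontinuous.lowerSemicontinuousOn _)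
    (fun w hw => by
      have hc : ConvexOn ℝ (convexHull ℝ (Set.range y)) fun z => f z w := by
        refine ⟨convex_convexHull ℝ _, fun z _ u _ s t hs ht hst => ?_⟩
        simp only [f, smul_eq_mul, Finset.mul_sum, ← Finset.sum_add_distrib]
        refine Finset.sum_le_sum fun i _ => ?_
        have := (convexOn_inner_add_sub (v i - x) (y i)).2 (Set.mem_univ z) (Set.mem_univ u) hs ht hst
        simp only [smul_eq_mul] at this
        have := mul_le_mul_of_nonneg_left this (hw.1 i)
        linarith
      exact hc.quasiconvexOn)
    (convex_stdSimplex ℝ ι) ⟨_, single_mem_stdSimplex ℝ i₀⟩ (isCompact_stdSimplex ℝ ι)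
    (fun a _ => (by fun_prop : Continuous (f a)).upperSemicontinuous.upperSemicontinuousOn _)
    (fun a _ => by
      have hc : ConcaveOn ℝ (stdSimplex ℝ ι) (f a) :=
        ⟨convex_stdSimplex ℝ ι, fun w₁ _ w₂ _ s t _ _ _ => by
          simp only [smul_eq_mul, hlin, le_refl]⟩
      exact hc.quasiconcaveOn)
  refine ⟨a, fun i => ?_⟩
  have hmem : (∑ j, b j • y j) ∈ convexHull ℝ (Set.range y) :=
    (convex_convexHull ℝ _).sum_mem (fun j _ => hb.1 j) hb.2
      fun j _ => subset_convexHull ℝ _ ⟨j, rfl⟩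
  have h1 := hab _ hmem _ (single_mem_stdSimplex ℝ i)
  have h2 := sum_inner_barycentre_nonpos y v x hmono b hb.1 hb.2
  have h3 : f a (Pi.single i 1) = inner ℝ (v i - x + a) (a - y i) := by
    simp [f, Pi.single_apply]
  rw [← h3]
  exact h1.trans h2

/-- Adjoining `(z, w)` to the graph keeps it monotone, so maximality forces the point to be there
already. -/
theorem IsMaximalMonotoneOp.mem_of_forall {A : E → Set E} (hA : IsMaximalMonotoneOp A) {z w : E}
    (h : ∀ y, ∀ v ∈ A y, 0 ≤ inner ℝ (w - v) (z - y)) : w ∈ A z := by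
  have hB := hA.2 (fun y => A y ∪ {v | y = z ∧ v = w}) ?_ fun y => Set.subset_union_left
  · rw [← hB]; exact Or.inr ⟨rfl, rfl⟩
  · rintro x y u (hu | ⟨rfl, rfl⟩) v (hv | ⟨rfl, rfl⟩)
    · exact hA.1 x y u hu v hv
    · have := h x u hu
      rwa [← neg_sub u, ← neg_sub x, inner_neg_neg] at this
    · exact h y v hv
    · simp

/-- A maximally monotone operator is not empty. -/
theorem IsMaximalMonotoneOp.exists_mem {A : E → Set E} (hA : IsMaximalMonotoneOp A) :
    ∃ y v, v ∈ A y := by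
  by_contra! h
  exact h 0 0 (hA.mem_of_forall fun y v hv => (h y v hv).elim)

/-- **Minty's theorem** in finite dimension: `Id + A` is surjective. -/
theorem IsMaximalMonotoneOp.resolventSet_nonempty [FiniteDimensional ℝ E] {A : E → Set E}
    (hA : IsMaximalMonotoneOp A) (x : E) : (resolventSet A x).Nonempty := by
  classical
  have : ProperSpace E := FiniteDimensional.proper ℝ E
  obtain ⟨y₀, v₀, h₀⟩ := hA.exists_mem
  let ι := {p : E × E // p.2 ∈ A p.1}
  let i₀ : ι := ⟨(y₀, v₀), h₀⟩
  let t : ι → Set E := fun p => {z | inner ℝ (p.1.2 - x + z) (z - p.1.1) ≤ 0}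
  have ht (p : ι) : IsClosed (t p) :=
    isClosed_le (by fun_prop) continuous_const
  have hball : t i₀ ⊆ Metric.closedBall y₀ ‖x - v₀ - y₀‖ := by
    intro z hz
    have hz : inner ℝ (v₀ - x + z) (z - y₀) ≤ 0 := hz
    rw [Metric.mem_closedBall, dist_eq_norm]
    have e : v₀ - x + z = (z - y₀) - (x - v₀ - y₀) := by abel
    rw [e, inner_sub_left, real_inner_self_eq_norm_sq] at hz
    have := real_inner_le_norm (x - v₀ - y₀) (z - y₀)
    by_contra! hlt
    nlinarith [norm_nonneg (x - v₀ - y₀)]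
  -- Finite intersection property. Adding `i₀` to each finite subfamily places the common point in
  -- the compact ball.
  obtain ⟨z, -, hz⟩ := (isCompact_closedBall y₀ ‖x - v₀ - y₀‖).inter_iInter_nonempty t ht fun u => by
    obtain ⟨z, hz⟩ := exists_forall_inner_nonpos_of_finite
      (fun p : (insert i₀ u : Finset ι) => p.1.1.1) (fun p => p.1.1.2) x
      fun p q => hA.1 _ _ _ p.1.2 _ q.1.2
    refine ⟨z, hball (hz ⟨i₀, by simp⟩), Set.mem_iInter₂.2 fun p hp => hz ⟨p, by simp [hp]⟩⟩
  refine ⟨z, x - z, hA.mem_of_forall fun y v hv => ?_, by abel⟩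
  have h1 : inner ℝ (v - x + z) (z - y) ≤ 0 := Set.mem_iInter.1 hz ⟨(y, v), hv⟩
  have e : x - z - v = -(v - x + z) := by abel
  rw [e, inner_neg_left]
  linarith

/-! ### Resolvents of maximally monotone operators -/

theorem IsMaximalMonotoneOp.smulOp {A : E → Set E} (hA : IsMaximalMonotoneOp A) {c : ℝ}
    (hc : 0 < c) : IsMaximalMonotoneOp (smulOp c A) := by
  have hmono {B : E → Set E} (hB : IsMonotoneOp B) {r : ℝ} (hr : 0 < r) :
      IsMonotoneOp (WeakMVI.smulOp r B) := by
    rintro x y _ ⟨u, hu, rfl⟩ _ ⟨v, hv, rfl⟩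
    rw [← smul_sub, real_inner_smul_left]
    exact mul_nonneg hr.le (hB x y u hu v hv)
  refine ⟨hmono hA.1 hc, fun B hB hsub => ?_⟩
  have h := hA.2 (WeakMVI.smulOp c⁻¹ B) (hmono hB (inv_pos.2 hc)) fun x u hu =>
    ⟨c • u, hsub x ⟨u, hu, rfl⟩, (inv_smul_smul₀ hc.ne' u).symm⟩
  refine funext fun x => Set.Subset.antisymm (fun u hu => ?_) (hsub x)
  refine ⟨c⁻¹ • u, ?_, (smul_inv_smul₀ hc.ne' u).symm⟩
  rw [← h]
  exact ⟨u, hu, rfl⟩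

theorem IsMaximalMonotoneOp.resolvent_mem [FiniteDimensional ℝ E] {A : E → Set E}
    (hA : IsMaximalMonotoneOp A) (x : E) : resolvent A x ∈ resolventSet A x :=
  Classical.epsilon_spec (hA.resolventSet_nonempty x)

theorem IsMonotoneOp.norm_sub_le_of_mem_resolventSet {A : E → Set E} (hA : IsMonotoneOp A)
    {x x' y y' : E} (hy : y ∈ resolventSet A x) (hy' : y' ∈ resolventSet A x') :
    ‖y - y'‖ ≤ ‖x - x'‖ := by
  obtain ⟨u, hu, rfl⟩ := hy
  obtain ⟨u', hu', rfl⟩ := hy'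
  have h := hA y y' u hu u' hu'
  have e : y + u - (y' + u') = (y - y') + (u - u') := by abel
  have h1 : ‖y - y'‖ ^ 2 ≤ ‖y + u - (y' + u')‖ ^ 2 := by
    rw [e, norm_add_sq_real, real_inner_comm]
    nlinarith [sq_nonneg ‖u - u'‖]
  exact (pow_le_pow_iff_left₀ (norm_nonneg _) (norm_nonneg _) two_ne_zero).1 h1

/-- Turns the resolvent of the sum into the fixed-point equation `z = J_{ηG}(x - ηF z)`. -/
theorem mem_resolventSet_smulOp_sumOp {F : E → E} {G : E → Set E} {η : ℝ} {x z : E} :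
    z ∈ resolventSet (smulOp η (sumOp F G)) x ↔ z ∈ resolventSet (smulOp η G) (x - η • F z) := by
  constructor
  · rintro ⟨_, ⟨_, ⟨g, hg, rfl⟩, rfl⟩, hx⟩
    exact ⟨η • g, ⟨g, hg, rfl⟩, by rw [hx, smul_add]; abel⟩
  · rintro ⟨_, ⟨g, hg, rfl⟩, hx⟩
    exact ⟨η • (F z + g), ⟨F z + g, ⟨g, hg, rfl⟩, rfl⟩, by
      rw [sub_eq_iff_eq_add] at hx; rw [hx, smul_add]; abel⟩

/-- The resolvent of `η (F + G)` is single-valued when `F` is `L`-Lipschitz with `η L < 1`. -/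
theorem exists_resolventSet_eq_singleton [FiniteDimensional ℝ E] {F : E → E} {G : E → Set E}
    {L : ℝ≥0} {η : ℝ} (hF : LipschitzWith L F) (hG : IsMaximalMonotoneOp G) (hη : 0 < η)
    (hηL : η * L < 1) (x : E) : ∃ p, resolventSet (smulOp η (sumOp F G)) x = {p} := by
  have hA := hG.smulOp hη
  let T : E → E := fun z => resolvent (smulOp η G) (x - η • F z)
  have hT : ContractingWith (η.toNNReal * L) T := by
    refine ⟨?_, LipschitzWith.of_dist_le_mul fun z w => ?_⟩
    · rw [← NNReal.coe_lt_coe]; simpa [hη.le] using hηL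
    · have h := hA.1.norm_sub_le_of_mem_resolventSet (hA.resolvent_mem (x - η • F z))
        (hA.resolvent_mem (x - η • F w))
      have e : x - η • F z - (x - η • F w) = η • (F w - F z) := by rw [smul_sub]; abel
      rw [e, norm_smul, Real.norm_of_nonneg hη.le, norm_sub_rev (F w)] at h
      have h2 := hF.dist_le_mul z w
      rw [dist_eq_norm] at h2
      have := mul_le_mul_of_nonneg_left h2 hη.le
      rw [dist_eq_norm (T z)]
      simp only [NNReal.coe_mul, Real.coe_toNNReal _ hη.le]
      linarith
  have : CompleteSpace E := FiniteDimensional.complete ℝ E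
  refine ⟨hT.fixedPoint T, Set.eq_singleton_iff_unique_mem.2 ⟨?_, fun z hz => ?_⟩⟩
  · rw [mem_resolventSet_smulOp_sumOp]
    have := hA.resolvent_mem (x - η • F (hT.fixedPoint T))
    rwa [show resolvent (smulOp η G) (x - η • F (hT.fixedPoint T)) = hT.fixedPoint T from
      hT.fixedPoint_isFixedPt] at this
  · refine hT.fixedPoint_unique ?_
    rw [mem_resolventSet_smulOp_sumOp] at hz
    have := hA.1.norm_sub_le_of_mem_resolventSet (hA.resolvent_mem (x - η • F z)) hz
    rw [sub_self, norm_zero, norm_le_zero_iff, sub_eq_zero] at this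
    exact this

end WeakMVI

namespace WeakMVI

variable {E : Type*} [NormedAddCommGroup E] [InnerProductSpace ℝ E]

/-! ### The forward-backward-forward method -/

theorem approxResolvent_calls (F : E → E) (G : E → Set E) (η L : ℝ) (N : ℕ) (x : E) :
    (approxResolvent F G η L N x).calls = 3 * N := by
  induction N with
  | zero => rfl
  | succ N ih =>
    simp only [approxResolvent, fbf, Counted.bind, Counted.query, Counted.pure] at ih ⊢
    omega

/-- One step of the method, with `u = z - zHalf`, `w = zHalf - p` and `d` the correction. -/
theorem norm_add_sq_le_of_inner_ge {u w d : E} {κ : ℝ} (hκ0 : 0 ≤ κ) (hκ1 : κ ≤ 1)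
    (hd : ‖d‖ ≤ ‖u‖ / 2) (h : κ / 2 * ‖w‖ ^ 2 ≤ inner ℝ w (u - d)) :
    ‖w + d‖ ^ 2 ≤ (1 - 3 / 7 * κ) * ‖u + w‖ ^ 2 := by
  have h1 := norm_add_sq_real w d
  have h2 := norm_add_sq_real u w
  rw [inner_sub_right, real_inner_comm u w] at h
  have hd2 : ‖d‖ ^ 2 ≤ ‖u‖ ^ 2 / 4 := by nlinarith [norm_nonneg d, norm_nonneg u]
  -- The hypotheses bound the decrease below by `3/4‖u‖² + κ‖w‖²`, hence by `κ(3/4‖u‖² + ‖w‖²)`. The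
  -- square `‖3u - 4w‖² ≥ 0` says that `3/4‖u‖² + ‖w‖² ≥ 3/7‖u + w‖²`.
  have h3 : 0 ≤ 9 * ‖u‖ ^ 2 - 24 * inner ℝ u w + 16 * ‖w‖ ^ 2 := by
    have := norm_sub_sq_real ((3 : ℝ) • u) ((4 : ℝ) • w)
    rw [norm_smul, norm_smul, real_inner_smul_left, real_inner_smul_right, Real.norm_of_nonneg
      (by norm_num), Real.norm_of_nonneg (by norm_num)] at this
    nlinarith [sq_nonneg ‖(3 : ℝ) • u - (4 : ℝ) • w‖]
  have h4 := mul_nonneg hκ0 h3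
  have h5 := mul_nonneg (sub_nonneg.2 hκ1) (sq_nonneg ‖u‖)
  rw [h2] at *
  nlinarith

variable [FiniteDimensional ℝ E] {F : E → E} {G : E → Set E} {L : ℝ≥0} {η : ℝ}

/-- The forward operator is `(1 + ηL)`-Lipschitz, so this `τ` keeps the correction below half of `z
- zh`. It is also `(1 - ηL)`-strongly monotone, which gives the inner product bound with `κ/2 = τ(1
- ηL)`. -/
theorem norm_approxResolvent_succ_sub_sq_le (hF : LipschitzWith L F)
    (hG : IsMaximalMonotoneOp G) (hη : 0 < η) (hηL : η * L < 1) {x p : E}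
    (hp : p ∈ resolventSet (smulOp η (sumOp F G)) x) (N : ℕ) :
    ‖(approxResolvent F G η L (N + 1) x).val - p‖ ^ 2 ≤
      (1 - 3 / 7 * ((1 - η * L) / (1 + η * L))) * ‖(approxResolvent F G η L N x).val - p‖ ^ 2 := by
  have hL : 0 ≤ η * (L : ℝ) := by positivity
  set ℓ : ℝ := 1 + η * L with hℓ
  have hℓ0 : 0 < ℓ := by positivity
  set τ : ℝ := 1 / (2 * ℓ) with hτ
  have hτ0 : 0 < τ := by positivity
  set z := (approxResolvent F G η L N x).val with hz
  set b := z + η • F z - x with hb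
  set zh := resolvent (smulOp τ (smulOp η G)) (z - τ • b) with hzh
  set bh := zh + η • F zh - x with hbh
  have hsucc : (approxResolvent F G η L (N + 1) x).val = zh + τ • b - τ • bh := rfl
  obtain ⟨_, ⟨_, ⟨g, hg, rfl⟩, rfl⟩, hzg⟩ := ((hG.smulOp hη).smulOp hτ0).resolvent_mem (z - τ • b)
  obtain ⟨_, ⟨g', hg', rfl⟩, hpg⟩ := mem_resolventSet_smulOp_sumOp.1 hp
  rw [← hzh] at hg hzg
  have hLip (a c : E) : ‖η • (F a - F c)‖ ≤ η * L * ‖a - c‖ := by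
    rw [norm_smul, Real.norm_of_nonneg hη.le, mul_assoc, ← dist_eq_norm, ← dist_eq_norm]
    exact mul_le_mul_of_nonneg_left (hF.dist_le_mul a c) hη.le
  -- The resolvent step, with the inclusion `0 = ηg' + p + ηF p - x` at `p` subtracted.
  have e1 : (z - zh) - τ • (b - bh) = τ • (η • (g - g') + ((zh - p) + η • (F zh - F p))) := by
    have e2 : z = zh + τ • η • g + τ • b := by rw [← hzg]; abel
    have e3 : η • g' = x - η • F p - p := by rw [hpg]; abel
    have e4 : z - zh - τ • (b - bh) = τ • (η • g + bh) := by
      rw [smul_sub, smul_add]; nth_rewrite 1 [e2]; abel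
    rw [e4, smul_sub η g, e3, smul_sub η (F zh), hbh]
    congr 1
    abel
  have hd : ‖τ • (b - bh)‖ ≤ ‖z - zh‖ / 2 := by
    have e5 : b - bh = (z - zh) + η • (F z - F zh) := by rw [hb, hbh, smul_sub]; abel
    have h6 : ‖b - bh‖ ≤ ℓ * ‖z - zh‖ := by
      rw [e5]
      refine (norm_add_le _ _).trans ?_
      have := hLip z zh
      rw [hℓ]; linarith
    rw [norm_smul, Real.norm_of_nonneg hτ0.le]
    calc τ * ‖b - bh‖ ≤ τ * (ℓ * ‖z - zh‖) := by gcongr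
      _ = ‖z - zh‖ / 2 := by rw [hτ]; field_simp
  have hin : (1 - η * L) / ℓ / 2 * ‖zh - p‖ ^ 2 ≤ inner ℝ (zh - p) ((z - zh) - τ • (b - bh)) := by
    rw [e1, real_inner_smul_right, inner_add_right, inner_add_right, real_inner_smul_right,
      real_inner_self_eq_norm_sq, real_inner_comm]
    have h7 := mul_nonneg hη.le (hG.1 zh p g hg g' hg')
    have h8 := neg_le_of_abs_le (abs_real_inner_le_norm (zh - p) (η • (F zh - F p)))
    have h9 := mul_le_mul_of_nonneg_left (hLip zh p) (norm_nonneg (zh - p))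
    have h10 : (1 - η * L) / ℓ / 2 * ‖zh - p‖ ^ 2 = τ * ((1 - η * L) * ‖zh - p‖ ^ 2) := by
      rw [hτ]; field_simp
    rw [h10]
    refine mul_le_mul_of_nonneg_left ?_ hτ0.le
    nlinarith
  have key := norm_add_sq_le_of_inner_ge (div_nonneg (by linarith) hℓ0.le)
    ((div_le_one hℓ0).2 (by rw [hℓ]; linarith)) hd hin
  rw [hsucc, show zh + τ • b - τ • bh - p = zh - p + τ • (b - bh) by rw [smul_sub τ b]; abel,
    show z - p = z - zh + (zh - p) by abel]
  exact key

/-- Linear convergence of the forward-backward-forward method to the exact resolvent. -/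
theorem norm_approxResolvent_sub_sq_le (hF : LipschitzWith L F)
    (hG : IsMaximalMonotoneOp G) (hη : 0 < η) (hηL : η * L < 1) {x p : E}
    (hp : p ∈ resolventSet (smulOp η (sumOp F G)) x) (N : ℕ) :
    ‖(approxResolvent F G η L N x).val - p‖ ^ 2 ≤
      (1 - 3 / 7 * ((1 - η * L) / (1 + η * L))) ^ N * ‖x - p‖ ^ 2 := by
  have hL : 0 ≤ η * (L : ℝ) := by positivity
  have hκ : (1 - η * L) / (1 + η * L) ≤ 1 := (div_le_one (by linarith)).2 (by linarith)
  induction N with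
  | zero => rw [pow_zero, one_mul]; rfl
  | succ N ih =>
    refine (norm_approxResolvent_succ_sub_sq_le hF hG hη hηL hp N).trans ?_
    rw [pow_succ' (1 - _), mul_assoc]
    exact mul_le_mul_of_nonneg_left ih (by linarith)

end WeakMVI

namespace WeakMVI

/-! ### The number of inner steps -/

/-- Only `log(k + 2) ≥ log 2` is used, with `8 log² 2 ≥ 3`. -/
theorem three_mul_le_eight_mul_log_sq (k : ℕ) :
    3 * ((k : ℝ) + 1) ≤ 8 * ((k : ℝ) + 1) * Real.log ((k : ℝ) + 2) ^ 2 := by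
  have h1 : Real.log 2 ≤ Real.log ((k : ℝ) + 2) :=
    Real.log_le_log (by norm_num) (by linarith [k.cast_nonneg (α := ℝ)])
  have h2 : 3 / 8 ≤ Real.log ((k : ℝ) + 2) ^ 2 := by nlinarith [Real.log_two_gt_d9]
  nlinarith [k.cast_nonneg (α := ℝ)]

/-- The contraction factor of the inner method after `innerSteps η L k` steps. -/
theorem pow_innerSteps_le {η L : ℝ} (h0 : 0 ≤ η * L) (h1 : η * L < 1) (k : ℕ) :
    (1 - 3 / 7 * ((1 - η * L) / (1 + η * L))) ^ innerSteps η L k ≤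
      1 / (5 * √((k : ℝ) + 1) ^ 3) := by
  set κ := (1 - η * L) / (1 + η * L) with hκ
  have hκ0 : 0 < κ := div_pos (by linarith) (by linarith)
  have hκ1 : κ ≤ 1 := (div_le_one (by linarith)).2 (by linarith)
  set Y := 8 * ((k : ℝ) + 1) * Real.log ((k : ℝ) + 2) ^ 2 with hY
  set N := innerSteps η L k
  have hk : (0 : ℝ) < (k : ℝ) + 1 := by positivity
  -- The exponent is `3/7 κN ≥ 12/7 log Y ≥ 24/7 log r ≥ 3 log r`, and `r³ = 3√3 (k+1)^{3/2}` with
  -- `3√3 ≥ 5`.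
  set r := √(3 * ((k : ℝ) + 1)) with hr
  have hr0 : 0 < r := Real.sqrt_pos.2 (by positivity)
  have hr1 : 1 ≤ r := Real.one_le_sqrt.2 (by linarith [k.cast_nonneg (α := ℝ)])
  have hlogY : 2 * Real.log r ≤ Real.log Y := by
    have : (2 : ℝ) * Real.log r = Real.log (3 * ((k : ℝ) + 1)) := by
      rw [hr, Real.log_sqrt (by positivity)]; ring
    rw [this]
    exact Real.log_le_log (by positivity) (three_mul_le_eight_mul_log_sq k)
  have hlogr := Real.log_nonneg hr1
  have hN : 4 * Real.log Y ≤ κ * N := by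
    have h2 : 4 * (1 + η * L) / (1 - η * L) * Real.log Y ≤ N := Nat.le_ceil _
    have h3 : κ * (4 * (1 + η * L) / (1 - η * L) * Real.log Y) = 4 * Real.log Y := by
      have : 1 - η * L ≠ 0 := by linarith
      have : 1 + η * L ≠ 0 := by linarith
      rw [hκ]; field_simp
    rw [← h3]
    exact mul_le_mul_of_nonneg_left h2 hκ0.le
  have hs3 : 5 * √((k : ℝ) + 1) ^ 3 ≤ r ^ 3 := by
    rw [hr, Real.sqrt_mul (by norm_num), mul_pow]
    have h3 : (√3 : ℝ) ^ 2 = 3 := Real.sq_sqrt (by norm_num)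
    have h4 : (5 / 3 : ℝ) ≤ √3 := Real.le_sqrt_of_sq_le (by norm_num)
    gcongr
    nlinarith
  calc (1 - 3 / 7 * κ) ^ N ≤ Real.exp (-(3 / 7 * κ)) ^ N := by
        gcongr
        · linarith
        · linarith [Real.add_one_le_exp (-(3 / 7 * κ))]
    _ = Real.exp (-(3 / 7 * (κ * N))) := by rw [← Real.exp_nat_mul]; ring_nf
    _ ≤ Real.exp (-((3 : ℕ) * Real.log r)) := by
        apply Real.exp_le_exp.2
        push_cast
        linarith
    _ = 1 / r ^ 3 := by
        rw [Real.exp_neg, Real.exp_nat_mul, Real.exp_log hr0, one_div]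
    _ ≤ 1 / (5 * √((k : ℝ) + 1) ^ 3) := by
        gcongr

theorem sum_one_div_sqrt_pow_three_le (n : ℕ) :
    ∑ k ∈ Finset.range n, 1 / √((k : ℝ) + 1) ^ 3 ≤ 3 := by
  -- The integral-test tail `2/√(n+1)` makes the induction close by telescoping.
  suffices h : ∀ n : ℕ, ∑ k ∈ Finset.range (n + 1), 1 / √((k : ℝ) + 1) ^ 3 ≤
      3 - 2 / √((n : ℝ) + 1) by
    cases n with
    | zero => simp
    | succ n => exact (h n).trans (by linarith [show 0 ≤ 2 / √((n : ℝ) + 1) by positivity])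
  intro n
  induction n with
  | zero => norm_num
  | succ n ih =>
    rw [Finset.sum_range_succ]
    have ha2 : √((n : ℝ) + 1) ^ 2 = n + 1 := Real.sq_sqrt (by positivity)
    have hb2 : √(((n + 1 : ℕ) : ℝ) + 1) ^ 2 = n + 1 + 1 := by
      rw [Real.sq_sqrt (by positivity)]; push_cast; ring
    have ha : 0 < √((n : ℝ) + 1) := Real.sqrt_pos.2 (by positivity)
    have hb : 0 < √(((n + 1 : ℕ) : ℝ) + 1) := Real.sqrt_pos.2 (by positivity)
    set a := √((n : ℝ) + 1)
    set b := √(((n + 1 : ℕ) : ℝ) + 1)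
    have hab : b ^ 2 - a ^ 2 = 1 := by linarith
    have hle : a ≤ b := by nlinarith
    have key : 1 / b ^ 3 ≤ 2 / a - 2 / b := by
      have h1 : 2 / a - 2 / b = 2 / (a * b * (a + b)) := by
        field_simp
        linarith
      rw [h1, div_le_div_iff₀ (by positivity) (by positivity)]
      nlinarith [mul_nonneg hb.le (sub_nonneg.2 hle), mul_nonneg (mul_nonneg hb.le hb.le) (sub_nonneg.2 hle),
        mul_nonneg (mul_nonneg hb.le ha.le) (sub_nonneg.2 hle)]
    linarith

/-! ### The Krasnoselskii-Mann iteration -/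

section KM

variable {E : Type*} [NormedAddCommGroup E] [InnerProductSpace ℝ E]

/-- Young's inequality with weight `2q` on the cross term, combined with `‖v - r‖² ≤ ‖v‖² - ‖r‖²`.
-/
theorem norm_sub_add_sq_le {v r e : E} {q : ℝ} (hq : 0 < q) (hr : ‖r‖ ^ 2 ≤ inner ℝ r v)
    (he : ‖e‖ ^ 2 ≤ q * ‖r‖ ^ 2) :
    ‖v - r + e‖ ^ 2 ≤ (1 + 2 * q) * ‖v‖ ^ 2 - ‖r‖ ^ 2 / 2 := by
  have h1 := norm_add_sq_real (v - r) e
  have h2 := norm_sub_sq_real v r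
  rw [real_inner_comm] at h2
  have h3 := norm_sub_sq_real ((2 * q) • (v - r)) e
  rw [norm_smul, real_inner_smul_left, Real.norm_of_nonneg (by positivity)] at h3
  have h4 : 2 * inner ℝ (v - r) e ≤ 2 * q * ‖v - r‖ ^ 2 + ‖r‖ ^ 2 / 2 := by
    have h5 := sq_nonneg ‖(2 * q) • (v - r) - e‖
    rw [h3] at h5
    have h6 : q * (2 * inner ℝ (v - r) e) ≤ q * (2 * q * ‖v - r‖ ^ 2 + ‖r‖ ^ 2 / 2) := by
      nlinarith
    exact le_of_mul_le_mul_left h6 hq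
  have h7 : ‖v - r‖ ^ 2 ≤ ‖v‖ ^ 2 - ‖r‖ ^ 2 := by linarith
  have h8 := mul_le_mul_of_nonneg_left h7 (by linarith : 0 ≤ 1 + 2 * q)
  have h9 := mul_nonneg hq.le (sq_nonneg ‖r‖)
  linarith

/-- Discrete Grönwall: as `1 + q n ≥ 1`, the accumulated decrease can be carried along with `D n`.
-/
theorem add_sum_le_exp_sum_mul {D σ q : ℕ → ℝ} (hσ : ∀ n, 0 ≤ σ n)
    (hq : ∀ n, 0 ≤ q n) (h : ∀ n, D (n + 1) ≤ (1 + q n) * D n - σ n) (hD : ∀ n, 0 ≤ D n) (n : ℕ) :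
    D n + ∑ k ∈ Finset.range n, σ k ≤ Real.exp (∑ k ∈ Finset.range n, q k) * D 0 := by
  induction n with
  | zero => simp
  | succ n ih =>
    rw [Finset.sum_range_succ, Finset.sum_range_succ, Real.exp_add]
    have hs : 0 ≤ ∑ k ∈ Finset.range n, σ k := Finset.sum_nonneg fun k _ => hσ k
    have h0 : 0 ≤ D n + ∑ k ∈ Finset.range n, σ k := add_nonneg (hD n) hs
    calc D (n + 1) + (∑ k ∈ Finset.range n, σ k + σ n)
        ≤ (1 + q n) * (D n + ∑ k ∈ Finset.range n, σ k) := by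
          nlinarith [h n, mul_nonneg (hq n) hs]
      _ ≤ Real.exp (q n) * (D n + ∑ k ∈ Finset.range n, σ k) := by
          gcongr
          linarith [Real.add_one_le_exp (q n)]
      _ ≤ Real.exp (q n) * (Real.exp (∑ k ∈ Finset.range n, q k) * D 0) := by gcongr
      _ = _ := by ring

variable {F : E → E} {G : E → Set E} {η ρ : ℝ}

/-- The weak Minty inequality in terms of the resolvent. -/
theorem IsWeakMVISolution.mul_norm_sq_le_inner {xs x p : E} (h : IsWeakMVISolution F G ρ xs)
    (hη : 0 < η) (hp : p ∈ resolventSet (smulOp η (sumOp F G)) x) :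
    (1 - ρ / η) * ‖x - p‖ ^ 2 ≤ inner ℝ (x - p) (x - xs) := by
  obtain ⟨_, ⟨u, hu, rfl⟩, rfl⟩ := hp
  have h1 := mul_le_mul_of_nonneg_left (h.2 p u hu) hη.le
  rw [add_sub_cancel_left, show p + η • u - xs = η • u + (p - xs) by abel, inner_add_right,
    real_inner_self_eq_norm_sq, real_inner_smul_left, norm_smul, Real.norm_of_nonneg hη.le]
  have h2 : (1 - ρ / η) * (η * ‖u‖) ^ 2 = (η * ‖u‖) ^ 2 + η * (-ρ * ‖u‖ ^ 2) := by
    field_simp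
    ring
  linarith

variable [FiniteDimensional ℝ E] {L : ℝ≥0}

theorem norm_inexactKM_succ_sub_sq_le (hF : LipschitzWith L F) (hG : IsMaximalMonotoneOp G)
    {xs : E} (hxs : IsWeakMVISolution F G ρ xs) (hη : 0 < η) (hρ : ρ < η) (hηL : η * L < 1)
    (x₀ : E) (k : ℕ) {p : E}
    (hp : p ∈ resolventSet (smulOp η (sumOp F G)) (inexactKM F G η L ρ x₀ k).val) :
    ‖(inexactKM F G η L ρ x₀ (k + 1)).val - xs‖ ^ 2 ≤
      (1 + 2 / 5 * (1 / √((k : ℝ) + 1) ^ 3)) * ‖(inexactKM F G η L ρ x₀ k).val - xs‖ ^ 2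
        - ((1 - ρ / η) * ‖(inexactKM F G η L ρ x₀ k).val - p‖) ^ 2 / 2 := by
  have hα : 0 < 1 - ρ / η := sub_pos.2 ((div_lt_one hη).2 hρ)
  set α := 1 - ρ / η with hαdef
  set x := (inexactKM F G η L ρ x₀ k).val
  set y := (approxResolvent F G η L (innerSteps η L k) x).val
  have hsucc : (inexactKM F G η L ρ x₀ (k + 1)).val = (1 - α) • x + α • y := rfl
  have hs : 0 < √((k : ℝ) + 1) := Real.sqrt_pos.2 (by positivity)
  have hy : ‖y - p‖ ^ 2 ≤ 1 / (5 * √((k : ℝ) + 1) ^ 3) * ‖x - p‖ ^ 2 :=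
    (norm_approxResolvent_sub_sq_le hF hG hη hηL hp _).trans
      (mul_le_mul_of_nonneg_right (pow_innerSteps_le (by positivity) hηL k) (sq_nonneg _))
  have h1 := hxs.mul_norm_sq_le_inner hη hp
  have key := norm_sub_add_sq_le (v := x - xs) (r := α • (x - p)) (e := α • (y - p))
    (q := 1 / (5 * √((k : ℝ) + 1) ^ 3)) (by positivity)
    (by
      rw [norm_smul, Real.norm_of_nonneg hα.le, real_inner_smul_left, mul_pow, sq α, mul_assoc]
      exact mul_le_mul_of_nonneg_left h1 hα.le)
    (by
      rw [norm_smul, norm_smul, Real.norm_of_nonneg hα.le, mul_pow, mul_pow, mul_left_comm]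
      exact mul_le_mul_of_nonneg_left hy (sq_nonneg α))
  rw [norm_smul, Real.norm_of_nonneg hα.le] at key
  have e1 : (1 - α) • x + α • y - xs = x - xs - α • (x - p) + α • (y - p) := by
    rw [sub_smul, one_smul, smul_sub, smul_sub]; abel
  have e2 : 2 / 5 * (1 / √((k : ℝ) + 1) ^ 3) = 2 * (1 / (5 * √((k : ℝ) + 1) ^ 3)) := by
    field_simp
  rw [hsucc, e1, e2]
  exact key

/-- Here `6/5 = 2/5 · 3` bounds the summed growth rates. Undoing the halved decrease then yields `2
· 11/2 = 11`. -/
theorem exp_six_fifths_le : Real.exp (6 / 5) ≤ 11 / 2 := by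
  have h : Real.exp (6 / 5) ^ 5 ≤ (11 / 2 : ℝ) ^ 5 := by
    rw [← Real.exp_nat_mul, show ((5 : ℕ) : ℝ) * (6 / 5) = (6 : ℕ) * 1 by norm_num,
      Real.exp_nat_mul]
    calc Real.exp 1 ^ 6 ≤ (2.7182818286 : ℝ) ^ 6 := by
          gcongr; exact Real.exp_one_lt_d9.le
      _ ≤ _ := by norm_num
  exact (pow_le_pow_iff_left₀ (Real.exp_pos _).le (by norm_num) (by norm_num)).1 h

/-- The residuals of the inexact iteration are square summable. -/
theorem sum_norm_inexactKM_sub_sq_le (hF : LipschitzWith L F) (hG : IsMaximalMonotoneOp G)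
    {xs : E} (hxs : IsWeakMVISolution F G ρ xs) (hη : 0 < η) (hρ : ρ < η) (hηL : η * L < 1)
    (x₀ : E) {p : ℕ → E}
    (hp : ∀ k, p k ∈ resolventSet (smulOp η (sumOp F G)) (inexactKM F G η L ρ x₀ k).val) (n : ℕ) :
    ∑ k ∈ Finset.range n, ((1 - ρ / η) * ‖(inexactKM F G η L ρ x₀ k).val - p k‖) ^ 2 ≤
      11 * ‖x₀ - xs‖ ^ 2 := by
  have h := add_sum_le_exp_sum_mul
    (D := fun k => ‖(inexactKM F G η L ρ x₀ k).val - xs‖ ^ 2)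
    (σ := fun k => ((1 - ρ / η) * ‖(inexactKM F G η L ρ x₀ k).val - p k‖) ^ 2 / 2)
    (q := fun k => 2 / 5 * (1 / √((k : ℝ) + 1) ^ 3))
    (fun k => by positivity) (fun k => by positivity)
    (fun k => norm_inexactKM_succ_sub_sq_le hF hG hxs hη hρ hηL x₀ k (hp k))
    (fun k => by positivity) n
  rw [← Finset.mul_sum, ← Finset.sum_div] at h
  have h1 : Real.exp (2 / 5 * ∑ k ∈ Finset.range n, 1 / √((k : ℝ) + 1) ^ 3) ≤ 11 / 2 :=
    (Real.exp_le_exp.2 (by linarith [sum_one_div_sqrt_pow_three_le n])).trans exp_six_fifths_le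
  have h2 := mul_le_mul_of_nonneg_right h1 (sq_nonneg ‖x₀ - xs‖)
  have h3 : (inexactKM F G η L ρ x₀ 0).val = x₀ := rfl
  simp only [h3] at h
  have h4 := sq_nonneg ‖(inexactKM F G η L ρ x₀ n).val - xs‖
  linarith

end KM

/-! ### The number of oracle calls -/

theorem inexactKM_calls {E : Type*} [NormedAddCommGroup E] [InnerProductSpace ℝ E] (F : E → E)
    (G : E → Set E) (η L ρ : ℝ) (x₀ : E) (K : ℕ) :
    (inexactKM F G η L ρ x₀ K).calls = ∑ k ∈ Finset.range K, 3 * innerSteps η L k := by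
  induction K with
  | zero => rfl
  | succ K ih =>
    rw [Finset.sum_range_succ, ← ih,
      ← approxResolvent_calls F G η L _ (inexactKM F G η L ρ x₀ K).val]
    rfl

theorem innerSteps_le {η L Λ : ℝ} (h0 : 0 ≤ η * L) (h1 : η * L < 1) (hΛ : 1 ≤ Λ) {k : ℕ}
    (hk : (k : ℝ) + 1 ≤ 12 * Λ) :
    (innerSteps η L k : ℝ) ≤ 41 * ((1 + η * L) / (1 - η * L)) * (1 + Real.log Λ) := by
  have hk0 := k.cast_nonneg (α := ℝ)
  have hY3 := three_mul_le_eight_mul_log_sq k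
  set Y := 8 * ((k : ℝ) + 1) * Real.log ((k : ℝ) + 2) ^ 2 with hY
  have hlogΛ := Real.log_nonneg hΛ
  have hlog : Real.log ((k : ℝ) + 2) ≤ 12 * Λ := by
    linarith [Real.log_le_sub_one_of_pos (show (0 : ℝ) < k + 2 by positivity)]
  have hlog0 : 0 ≤ Real.log ((k : ℝ) + 2) := Real.log_nonneg (by linarith)
  -- A power of two above `8 · 12³`, so that `14 log 2 ≤ 10`. The final `41` is `4 · 10` plus `1`
  -- for the ceiling.
  have hYle : Y ≤ 2 ^ 14 * Λ ^ 3 := by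
    calc Y ≤ 8 * (12 * Λ) * (12 * Λ) ^ 2 := by rw [hY]; gcongr
      _ = 13824 * Λ ^ 3 := by ring
      _ ≤ 2 ^ 14 * Λ ^ 3 := by gcongr; norm_num
  have hlogY : Real.log Y ≤ 10 * (1 + Real.log Λ) := by
    have h2 : Real.log Y ≤ Real.log (2 ^ 14 * Λ ^ 3) := Real.log_le_log (by linarith) hYle
    have h3 : Real.log (2 ^ 14 * Λ ^ 3) = 14 * Real.log 2 + 3 * Real.log Λ := by
      rw [Real.log_mul (by positivity) (by positivity), Real.log_pow, Real.log_pow]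
      norm_num
    linarith [Real.log_two_lt_d9]
  set c := (1 + η * L) / (1 - η * L) with hc
  have hc1 : 1 ≤ c := (one_le_div (by linarith)).2 (by linarith)
  have hlogY0 : 0 ≤ Real.log Y := Real.log_nonneg (by linarith)
  have hexpr : 4 * (1 + η * L) / (1 - η * L) * Real.log Y = 4 * c * Real.log Y := by
    rw [hc, mul_div_assoc]
  have hceil : (innerSteps η L k : ℝ) < 4 * c * Real.log Y + 1 := by
    rw [← hexpr]
    exact Nat.ceil_lt_add_one (by rw [hexpr]; positivity)
  have h6 : 4 * c * Real.log Y ≤ 4 * c * (10 * (1 + Real.log Λ)) := by gcongr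
  nlinarith

theorem inexactKM_calls_le {E : Type*} [NormedAddCommGroup E] [InnerProductSpace ℝ E] (F : E → E)
    (G : E → Set E) {η L Λ : ℝ} (ρ : ℝ) (x₀ : E) {K : ℕ} (h0 : 0 ≤ η * L) (h1 : η * L < 1)
    (hΛ : 1 ≤ Λ) (hK : (K : ℝ) ≤ 12 * Λ) :
    ((inexactKM F G η L ρ x₀ K).calls : ℝ) ≤
      1476 * ((1 + η * L) / (1 - η * L)) * Λ * (1 + Real.log Λ) := by
  rw [inexactKM_calls]
  push_cast
  have hlogΛ := Real.log_nonneg hΛ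
  have hc : 0 ≤ (1 + η * L) / (1 - η * L) := div_nonneg (by linarith) (by linarith)
  set c := (1 + η * L) / (1 - η * L)
  have hterm : ∀ k ∈ Finset.range K,
      3 * (innerSteps η L k : ℝ) ≤ 3 * (41 * c * (1 + Real.log Λ)) := fun k hk => by
    have : (k : ℝ) + 1 ≤ K := by exact_mod_cast Finset.mem_range.1 hk
    gcongr
    exact innerSteps_le h0 h1 hΛ (this.trans hK)
  refine (Finset.sum_le_card_nsmul _ _ _ hterm).trans ?_
  rw [Finset.card_range, nsmul_eq_mul]
  calc (K : ℝ) * (3 * (41 * c * (1 + Real.log Λ)))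
      ≤ 12 * Λ * (3 * (41 * c * (1 + Real.log Λ))) := by gcongr
    _ = _ := by ring

end WeakMVI

/-! ### Best residual and total cost -/

theorem corollary2 :
    ∃ C : ℝ, 0 < C ∧
      ∀ (d : ℕ) (L : ℝ≥0) (η ρ : ℝ)
        (F : EuclideanSpace ℝ (Fin d) → EuclideanSpace ℝ (Fin d))
        (G : EuclideanSpace ℝ (Fin d) → Set (EuclideanSpace ℝ (Fin d)))
        (x₀ xs : EuclideanSpace ℝ (Fin d)) (ε : ℝ) (K : ℕ),
        LipschitzWith L F →
        WeakMVI.IsMaximalMonotoneOp G →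
        WeakMVI.IsWeakMVISolution F G ρ xs →
        0 < ρ → ρ < η → η * (L : ℝ) < 1 → 0 < ε →
        K = max 1 ⌈11 * ‖x₀ - xs‖ ^ 2 / ((η - ρ) ^ 2 * ε ^ 2)⌉₊ →
        (∃ k < K, ∃ p : EuclideanSpace ℝ (Fin d),
          WeakMVI.resolventSet (WeakMVI.smulOp η (WeakMVI.sumOp F G))
            (WeakMVI.inexactKM F G η L ρ x₀ k).val = {p} ∧
          η⁻¹ * ‖(WeakMVI.inexactKM F G η L ρ x₀ k).val - p‖ ≤ ε) ∧
        ((WeakMVI.inexactKM F G η L ρ x₀ K).calls : ℝ) ≤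
          C * ((1 + η * L) / (1 - η * L)) *
            max 1 (‖x₀ - xs‖ ^ 2 / (ε ^ 2 * (η - ρ) ^ 2)) *
            (1 + Real.log (max 1 (‖x₀ - xs‖ ^ 2 / (ε ^ 2 * (η - ρ) ^ 2)))) := by
  refine ⟨1476, by norm_num, ?_⟩
  intro d L η ρ F G x₀ xs ε K hF hG hxs hρ0 hρ hηL hε hK
  have hη : 0 < η := hρ0.trans hρ
  have hgap : 0 < η - ρ := sub_pos.2 hρ
  have hc : 0 < (η - ρ) ^ 2 * ε ^ 2 := by positivity
  constructor
  · choose p hp using fun k => WeakMVI.exists_resolventSet_eq_singleton hF hG hη hηL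
      (WeakMVI.inexactKM F G η L ρ x₀ k).val
    suffices h : ∃ k < K, ‖(WeakMVI.inexactKM F G η L ρ x₀ k).val - p k‖ ≤ η * ε by
      obtain ⟨k, hk, h⟩ := h
      exact ⟨k, hk, p k, hp k, (inv_mul_le_iff₀ hη).2 h⟩
    by_contra! h
    have hsum := WeakMVI.sum_norm_inexactKM_sub_sq_le hF hG hxs hη hρ hηL x₀
      (fun k => (hp k).symm ▸ Set.mem_singleton (p k)) K
    have hlt : ∑ _k ∈ Finset.range K, (η - ρ) ^ 2 * ε ^ 2 <
        ∑ k ∈ Finset.range K,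
          ((1 - ρ / η) * ‖(WeakMVI.inexactKM F G η L ρ x₀ k).val - p k‖) ^ 2 := by
      -- The `max` with `1` in `K` matters here: strictness needs a nonempty sum, even when `x₀ =
      -- x*`.
      refine Finset.sum_lt_sum_of_nonempty
        (Finset.nonempty_range_iff.2 (by rw [hK]; exact (lt_max_of_lt_left one_pos).ne'))
        fun k hk => ?_
      have h1 : (η - ρ) * ε = (1 - ρ / η) * (η * ε) := by field_simp
      have hα : 0 < 1 - ρ / η := sub_pos.2 ((div_lt_one hη).2 hρ)
      rw [← mul_pow, h1]
      have := h k (Finset.mem_range.1 hk)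
      gcongr
    rw [Finset.sum_const, Finset.card_range, nsmul_eq_mul] at hlt
    have hKge : 11 * ‖x₀ - xs‖ ^ 2 / ((η - ρ) ^ 2 * ε ^ 2) ≤ K := by
      refine (Nat.le_ceil _).trans ?_
      rw [hK]
      exact_mod_cast le_max_right _ _
    rw [div_le_iff₀ hc] at hKge
    linarith
  · refine WeakMVI.inexactKM_calls_le F G ρ x₀ (by positivity) hηL (le_max_left _ _) ?_
    set q := ‖x₀ - xs‖ ^ 2 / (ε ^ 2 * (η - ρ) ^ 2) with hq
    have hq0 : 0 ≤ q := by positivity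
    have h1 : 11 * ‖x₀ - xs‖ ^ 2 / ((η - ρ) ^ 2 * ε ^ 2) = 11 * q := by
      rw [hq, mul_div_assoc, mul_comm (ε ^ 2)]
    have h2 : (⌈11 * q⌉₊ : ℝ) < 11 * q + 1 := Nat.ceil_lt_add_one (by positivity)
    have h3 : 1 ≤ max 1 q := le_max_left _ _
    have h4 : q ≤ max 1 q := le_max_right _ _
    rw [hK, h1]
    push_cast
    exact max_le (by linarith) (by linarith)
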